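/- Let $n\ge 2$, let $(\widetilde M,J,g)$ be a Kaehler manifold of real dimension $2n$ (that is, a Riemannian manifold with a smooth orthogonal almost complex structure $J$ that is parallel for the Levi-Civita connection), and let $M$ be an $n$-dimensional (isometrically immersed) submanifold of $\widetilde M$ with second fundamental form $\sigma$ and mean curvature vector $H=\frac1n\,\mathrm{trace}(\sigma)$. Suppose that (i) $M$ is a non-invariant slant submanifold: there is a constant $\theta\neq 0$ such that for every $p\in M$ and every nonzero $X\in T_pM$ the angle between $JX$ and the subspace $T_pM$ equals $\theta$; (ii) $M$ is totally umbilical: $\sigma(X,Y)=g(X,Y)H$ for all $p\in M$ and $X,Y\in T_pM$. Then $M$ is totally geodesic, i.e. $\sigma=0$. -/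

import Mathlib

open Bundle Manifold
open scoped Manifold ContDiff

noncomputable section

namespace SlantGeometry

section LeviCivita

variable {E : Type*} [NormedAddCommGroup E] [NormedSpace ℝ E]
  {H : Type*} [TopologicalSpace H] (I : ModelWithCorners ℝ E H)
  {M : Type*} [TopologicalSpace M] [ChartedSpace H M]
  [RiemannianBundle (fun x : M ↦ TangentSpace I x)]

/-- The right-hand side of the Koszul formula. -/
def koszul (X Y Z : Π x : M, TangentSpace I x) (x : M) : ℝ :=
  (1 / 2 : ℝ) *
    (mvfderiv I (fun y ↦ inner ℝ (Y y) (Z y)) x (X x)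
      + mvfderiv I (fun y ↦ inner ℝ (X y) (Z y)) x (Y x)
      - mvfderiv I (fun y ↦ inner ℝ (X y) (Y y)) x (Z x)
      + inner ℝ (VectorField.mlieBracket I X Y x) (Z x)
      - inner ℝ (VectorField.mlieBracket I X Z x) (Y x)
      - inner ℝ (VectorField.mlieBracket I Y Z x) (X x))

variable {I}

theorem inner_field_comm (X Y : Π x : M, TangentSpace I x) :
    (fun y ↦ inner ℝ (X y) (Y y)) = (fun y ↦ inner ℝ (Y y) (X y)) := by
  ext y; exact real_inner_comm _ _

variable [IsManifold I ∞ M] [IsContMDiffRiemannianBundle I ∞ E (fun x : M ↦ TangentSpace I x)]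

theorem mdifferentiableAt_inner {X Y : Π x : M, TangentSpace I x} {x : M}
    (hX : MDiffAt (T% X) x) (hY : MDiffAt (T% Y) x) :
    MDiffAt (fun y ↦ inner ℝ (X y) (Y y)) x :=
  MDifferentiableAt.inner_bundle (IB := I) (F := E) (E := fun x : M ↦ TangentSpace I x)
    (b := fun x => x) (v := X) (w := Y) (IM := I) (x := x) hX hY

theorem mvfderiv_inner_add_left {X X' Y : Π x : M, TangentSpace I x} {x : M}
    (hX : MDiffAt (T% X) x) (hX' : MDiffAt (T% X') x) (hY : MDiffAt (T% Y) x) :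
    mvfderiv I (fun y ↦ inner ℝ ((X + X') y) (Y y)) x =
     mvfderiv I (fun y ↦ inner ℝ (X y) (Y y)) x + mvfderiv I (fun y ↦ inner ℝ (X' y) (Y y)) x := by
  rw [← mvfderiv_add (mdifferentiableAt_inner hX hY) (mdifferentiableAt_inner hX' hY)]
  congr 1
  ext y; exact inner_add_left _ _ _

theorem mvfderiv_inner_add_right {X X' Y : Π x : M, TangentSpace I x} {x : M}
    (hX : MDiffAt (T% X) x) (hX' : MDiffAt (T% X') x) (hY : MDiffAt (T% Y) x) :
    mvfderiv I (fun y ↦ inner ℝ (Y y) ((X + X') y)) x =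
     mvfderiv I (fun y ↦ inner ℝ (Y y) (X y)) x + mvfderiv I (fun y ↦ inner ℝ (Y y) (X' y)) x := by
  rw [inner_field_comm Y, mvfderiv_inner_add_left hX hX' hY, inner_field_comm Y, inner_field_comm Y]

theorem mvfderiv_inner_smul_left {f : M → ℝ} {X Y : Π x : M, TangentSpace I x} {x : M}
    (hf : MDiffAt f x) (hX : MDiffAt (T% X) x) (hY : MDiffAt (T% Y) x) :
    mvfderiv I (fun y ↦ inner ℝ ((f • X) y) (Y y)) x =
     f x • mvfderiv I (fun y ↦ inner ℝ (X y) (Y y)) x +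
       (inner ℝ (X x) (Y x) : ℝ) • mvfderiv I f x := by
  rw [← mvfderiv_mul hf (mdifferentiableAt_inner hX hY)]
  congr 1
  ext y; exact real_inner_smul_left _ _ _

theorem mvfderiv_inner_smul_right {f : M → ℝ} {X Y : Π x : M, TangentSpace I x} {x : M}
    (hf : MDiffAt f x) (hX : MDiffAt (T% X) x) (hY : MDiffAt (T% Y) x) :
    mvfderiv I (fun y ↦ inner ℝ (Y y) ((f • X) y)) x =
     f x • mvfderiv I (fun y ↦ inner ℝ (Y y) (X y)) x +
       (inner ℝ (Y x) (X x) : ℝ) • mvfderiv I f x := by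
  rw [inner_field_comm Y, mvfderiv_inner_smul_left hf hX hY, inner_field_comm Y, real_inner_comm]

variable [CompleteSpace E]

theorem koszul_add_left {X X' Y Z : Π x : M, TangentSpace I x} {x : M}
    (hX : MDiffAt (T% X) x) (hX' : MDiffAt (T% X') x)
    (hY : MDiffAt (T% Y) x) (hZ : MDiffAt (T% Z) x) :
   koszul I (X + X') Y Z x = koszul I X Y Z x + koszul I X' Y Z x := by
  unfold koszul
  rw [mvfderiv_inner_add_left hX hX' hY, mvfderiv_inner_add_left hX hX' hZ]
  simp only [
    VectorField.mlieBracket_add_left hX hX', Pi.add_apply, inner_add_left, inner_add_right,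
    map_add, add_apply]
  ring

theorem koszul_smul_left {f : M → ℝ} {X Y Z : Π x : M, TangentSpace I x} {x : M}
    (hf : MDiffAt f x) (hX : MDiffAt (T% X) x)
    (hY : MDiffAt (T% Y) x) (hZ : MDiffAt (T% Z) x) :
   koszul I (f • X) Y Z x = f x * koszul I X Y Z x := by
  unfold koszul
  rw [mvfderiv_inner_smul_left hf hX hY, mvfderiv_inner_smul_left hf hX hZ]
  simp only [
    VectorField.mlieBracket_smul_left hf hX, Pi.smul_apply', inner_add_left, inner_smul_left,
    inner_smul_right, map_smul, add_apply, smul_apply,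
    smul_eq_mul, neg_smul, inner_neg_left, conj_trivial]
  ring

theorem koszul_add_right {X Y Z Z' : Π x : M, TangentSpace I x} {x : M}
    (hX : MDiffAt (T% X) x)
    (hY : MDiffAt (T% Y) x) (hZ : MDiffAt (T% Z) x) (hZ' : MDiffAt (T% Z') x) :
   koszul I X Y (Z + Z') x = koszul I X Y Z x + koszul I X Y Z' x := by
  unfold koszul
  rw [mvfderiv_inner_add_right hZ hZ' hY, mvfderiv_inner_add_right hZ hZ' hX]
  simp only [
    VectorField.mlieBracket_add_right hZ hZ', Pi.add_apply, inner_add_left, inner_add_right,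
    map_add, add_apply]
  ring

theorem koszul_smul_right {f : M → ℝ} {X Y Z : Π x : M, TangentSpace I x} {x : M}
    (hf : MDiffAt f x) (hX : MDiffAt (T% X) x)
    (hY : MDiffAt (T% Y) x) (hZ : MDiffAt (T% Z) x) :
   koszul I X Y (f • Z) x = f x * koszul I X Y Z x := by
  unfold koszul
  rw [mvfderiv_inner_smul_right hf hZ hY, mvfderiv_inner_smul_right hf hZ hX]
  simp only [
    VectorField.mlieBracket_smul_right hf hZ, Pi.smul_apply', inner_add_left, inner_smul_left,
    inner_smul_right, map_smul, add_apply, smul_apply,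
    smul_eq_mul, conj_trivial]
  rw [real_inner_comm (Y x) (Z x), real_inner_comm (X x) (Z x)]
  ring

theorem koszul_add_mid {X Y Y' Z : Π x : M, TangentSpace I x} {x : M}
    (hX : MDiffAt (T% X) x)
    (hY : MDiffAt (T% Y) x) (hY' : MDiffAt (T% Y') x) (hZ : MDiffAt (T% Z) x) :
   koszul I X (Y + Y') Z x = koszul I X Y Z x + koszul I X Y' Z x := by
  unfold koszul
  rw [mvfderiv_inner_add_right hY hY' hX, mvfderiv_inner_add_left hY hY' hZ]
  simp only [
    VectorField.mlieBracket_add_left hY hY', VectorField.mlieBracket_add_right hY hY',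
    Pi.add_apply, inner_add_left, inner_add_right,
    map_add, add_apply]
  ring

theorem koszul_smul_mid {f : M → ℝ} {X Y Z : Π x : M, TangentSpace I x} {x : M}
    (hf : MDiffAt f x) (hX : MDiffAt (T% X) x)
    (hY : MDiffAt (T% Y) x) (hZ : MDiffAt (T% Z) x) :
   koszul I X (f • Y) Z x = f x * koszul I X Y Z x +
     mvfderiv I f x (X x) * inner ℝ (Y x) (Z x) := by
  unfold koszul
  rw [mvfderiv_inner_smul_right hf hY hX, mvfderiv_inner_smul_left hf hY hZ]
  simp only [
    VectorField.mlieBracket_smul_right hf hY, VectorField.mlieBracket_smul_left hf hY,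
    Pi.smul_apply', inner_add_left, inner_smul_left,
    inner_smul_right, map_smul, add_apply, smul_apply,
    smul_eq_mul, neg_smul, inner_neg_left, conj_trivial]
  rw [real_inner_comm (X x) (Y x)]
  ring

variable [FiniteDimensional ℝ E]

instance (x : M) : FiniteDimensional ℝ (TangentSpace I x) := inferInstanceAs (FiniteDimensional ℝ E)

theorem exists_koszul (Y : Π x : M, TangentSpace I x) (x : M) :
    ∃ A : TangentSpace I x →L[ℝ] TangentSpace I x,
      MDiffAt (T% Y) x → ∀ X Z : Π x : M, TangentSpace I x, MDiffAt (T% X) x → MDiffAt (T% Z) x →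
        inner ℝ (A (X x)) (Z x) = koszul I X Y Z x := by
  by_cases hY : MDiffAt (T% Y) x
  swap
  · exact ⟨0, fun h => absurd h hY⟩
  have h₁ : ∀ Z : Π x : M, TangentSpace I x, MDiffAt (T% Z) x →
      TensorialAt I E (fun X : Π x : M, TangentSpace I x => koszul I X Y Z x) x := fun Z hZ =>
    ⟨fun hf hX => koszul_smul_left hf hX hY hZ, fun hX hX' => koszul_add_left hX hX' hY hZ⟩
  have h₂ : ∀ X : Π x : M, TangentSpace I x, MDiffAt (T% X) x →
      TensorialAt I E (fun Z : Π x : M, TangentSpace I x => koszul I X Y Z x) x := fun X hX =>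
    ⟨fun hf hZ => koszul_smul_right hf hX hY hZ, fun hZ hZ' => koszul_add_right hX hY hZ hZ'⟩
  let B := TensorialAt.mkHom₂ (fun X Z => koszul I X Y Z x) x h₁ h₂
  have : CompleteSpace (TangentSpace I x) := FiniteDimensional.complete ℝ _
  refine ⟨LinearMap.toContinuousLinearMap
    { toFun := fun u => (InnerProductSpace.toDual ℝ (TangentSpace I x)).symm (B u)
      map_add' := fun u v => by simp
      map_smul' := fun c u => by simp }, fun _ X Z hX hZ => ?_⟩
  have := TensorialAt.mkHom₂_apply h₁ h₂ hX hZ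
  rw [← this]
  exact InnerProductSpace.toDual_symm_apply


theorem exists_leviCivita (I : ModelWithCorners ℝ E H) (M : Type*) [TopologicalSpace M]
    [ChartedSpace H M] [RiemannianBundle (fun x : M ↦ TangentSpace I x)] [IsManifold I ∞ M]
    [IsContMDiffRiemannianBundle I ∞ E (fun x : M ↦ TangentSpace I x)] :
    ∃ cov : CovariantDerivative I E (fun x : M ↦ TangentSpace I x),
      cov.IsMetricCompatible ∧ cov.torsion = 0 := by
  classical
  choose A hA using exists_koszul (I := I) (M := M)
  have ext_aux : ∀ (x : M) (B C : TangentSpace I x →L[ℝ] TangentSpace I x),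
      (∀ X Z : Π x : M, TangentSpace I x, MDiffAt (T% X) x → MDiffAt (T% Z) x →
        inner ℝ (B (X x)) (Z x) = inner ℝ (C (X x)) (Z x)) → B = C := by
    intro x B C h
    ext u
    refine ext_inner_right ℝ fun w ↦ ?_
    have := h (FiberBundle.extend E u) (FiberBundle.extend E w)
      (FiberBundle.mdifferentiableAt_extend ..) (FiberBundle.mdifferentiableAt_extend ..)
    simpa using this
  have key : ∀ {X Y Z : Π x : M, TangentSpace I x} {x : M}, MDiffAt (T% X) x →
      MDiffAt (T% Y) x → MDiffAt (T% Z) x →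
      inner ℝ (A Y x (X x)) (Z x) = koszul I X Y Z x :=
    fun {X Y Z x} hX hY hZ ↦ hA Y x hY X Z hX hZ
  let cov : CovariantDerivative I E (fun x : M ↦ TangentSpace I x) :=
    { toFun := A
      isCovariantDerivativeOnUniv :=
        { add := by
            intro Y Y' x hY hY' _
            refine ext_aux x _ _ fun X Z hX hZ ↦ ?_
            rw [key hX (mdifferentiableAt_add_section hY hY') hZ, koszul_add_mid hX hY hY' hZ,
              add_apply, inner_add_left, key hX hY hZ, key hX hY' hZ]
          leibniz := by
            intro Y g x hY hg _
            refine ext_aux x _ _ fun X Z hX hZ ↦ ?_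
            rw [key hX (hg.smul_section hY) hZ, koszul_smul_mid hg hX hY hZ,
              add_apply, inner_add_left, smul_apply, real_inner_smul_left, key hX hY hZ,
              ContinuousLinearMap.smulRight_apply, real_inner_smul_left] } }
  refine ⟨cov, ?_, ?_⟩
  · rw [CovariantDerivative.isMetricCompatible_iff]
    intro x X Y Z hX hY hZ
    have h₁ : inner ℝ (cov Y x (X x)) (Z x) = koszul I X Y Z x := key hX hY hZ
    have h₂ : inner ℝ (Y x) (cov Z x (X x)) = koszul I X Z Y x := by
      rw [real_inner_comm]; exact key hX hZ hY
    simp only [h₁, h₂, koszul]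
    rw [VectorField.mlieBracket_swap_apply (V := Y) (W := Z), inner_field_comm Z Y]
    simp only [inner_neg_left]
    ring
  · rw [CovariantDerivative.torsion_eq_zero_iff]
    intro X Y x hX hY
    refine ext_inner_right ℝ fun w ↦ ?_
    have hZ : MDiffAt (T% (FiberBundle.extend E w : Π x : M, TangentSpace I x)) x :=
      FiberBundle.mdifferentiableAt_extend ..
    have h₁ := key hX hY hZ
    have h₂ := key hY hX hZ
    have hw : (FiberBundle.extend E w : Π x : M, TangentSpace I x) x = w := by simp
    rw [hw] at h₁ h₂
    have h₃ : inner ℝ (cov Y x (X x) - cov X x (Y x)) w =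
      inner ℝ (A Y x (X x)) w - inner ℝ (A X x (Y x)) w := inner_sub_left _ _ _
    rw [h₃, h₁, h₂, koszul, koszul, VectorField.mlieBracket_swap_apply (V := Y) (W := X),
      inner_field_comm Y X, hw]
    simp only [inner_neg_left]
    ring

/-- The Levi-Civita connection of a Riemannian manifold: the torsion-free metric connection. -/
def leviCivita (I : ModelWithCorners ℝ E H) (M : Type*) [TopologicalSpace M]
    [ChartedSpace H M] [RiemannianBundle (fun x : M ↦ TangentSpace I x)] [IsManifold I ∞ M]
    [IsContMDiffRiemannianBundle I ∞ E (fun x : M ↦ TangentSpace I x)] :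
    CovariantDerivative I E (fun x : M ↦ TangentSpace I x) :=
  (exists_leviCivita I M).choose

end LeviCivita

section Kaehler

variable {E : Type*} [NormedAddCommGroup E] [NormedSpace ℝ E] [CompleteSpace E]
  [FiniteDimensional ℝ E] {H : Type*} [TopologicalSpace H] (I : ModelWithCorners ℝ E H)
  {N : Type*} [TopologicalSpace N] [ChartedSpace H N] [IsManifold I ∞ N]
  [RiemannianBundle (fun x : N ↦ TangentSpace I x)]
  [IsContMDiffRiemannianBundle I ∞ E (fun x : N ↦ TangentSpace I x)]

/-- `J` is a Kaehler structure on the Riemannian manifold `N`: a smooth almost complex structure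
which is orthogonal for the metric and parallel for the Levi-Civita connection. -/
structure IsKaehler (J : Π x : N, TangentSpace I x →L[ℝ] TangentSpace I x) : Prop where
  contMDiff : ContMDiff I (I.prod 𝓘(ℝ, E →L[ℝ] E)) ∞
    (fun x ↦ TotalSpace.mk' (E →L[ℝ] E)
      (E := fun x : N ↦ TangentSpace I x →L[ℝ] TangentSpace I x) x (J x))
  sq_eq_neg (x : N) (v : TangentSpace I x) : J x (J x v) = -v
  inner_map_map (x : N) (v w : TangentSpace I x) : inner ℝ (J x v) (J x w) = inner ℝ v w
  parallel (x : N) (Y : Π y : N, TangentSpace I y) (hY : MDiffAt (T% Y) x)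
    (v : TangentSpace I x) :
    leviCivita I N (fun y ↦ J y (Y y)) x v = J x (leviCivita I N Y x v)

end Kaehler

section Submanifold

variable {E : Type*} [NormedAddCommGroup E] [NormedSpace ℝ E]
  {H : Type*} [TopologicalSpace H] (I : ModelWithCorners ℝ E H)
  {M : Type*} [TopologicalSpace M] [ChartedSpace H M]
  {E' : Type*} [NormedAddCommGroup E'] [NormedSpace ℝ E']
  {H' : Type*} [TopologicalSpace H'] (I' : ModelWithCorners ℝ E' H')
  {N : Type*} [TopologicalSpace N] [ChartedSpace H' N]
  [RiemannianBundle (fun x : N ↦ TangentSpace I' x)]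

/-- `f` is a smooth isometric immersion (it is an immersion because its differential preserves
the inner product, hence is injective), that is, `M` with its Riemannian metric is an immersed
submanifold of `N` with the induced metric. -/
structure IsIsometricImmersion [RiemannianBundle (fun x : M ↦ TangentSpace I x)]
    (f : M → N) : Prop where
  contMDiff : ContMDiff I I' ∞ f
  inner_mfderiv (p : M) (u v : TangentSpace I p) :
    inner ℝ (mfderiv I I' f p u) (mfderiv I I' f p v) = inner ℝ u v

variable [FiniteDimensional ℝ E']

/-- The tangential component of a vector of `N` at `f p`: its orthogonal projection onto the
image of `T_p M`. -/
def tangentialPart (f : M → N) (p : M) (w : TangentSpace I' (f p)) : TangentSpace I' (f p) :=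
  (LinearMap.range (mfderiv I I' f p).toLinearMap).starProjection w

/-- The normal component of a vector of `N` at `f p`. -/
def normalPart (f : M → N) (p : M) (w : TangentSpace I' (f p)) : TangentSpace I' (f p) :=
  w - tangentialPart I I' f p w

/-- The Wirtinger angle of a tangent vector `X` of `M` at `p`: the angle between `J X` and the
tangent space of `M`, i.e. the angle in `[0, π/2]` whose cosine is `|P X| / |J X|`, where `P X` is
the tangential component of `J X`. -/
def wirtingerAngle (J : Π x : N, TangentSpace I' x →L[ℝ] TangentSpace I' x) (f : M → N) (p : M)
    (X : TangentSpace I p) : ℝ :=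
  Real.arccos (‖tangentialPart I I' f p (J (f p) (mfderiv I I' f p X))‖ /
    ‖J (f p) (mfderiv I I' f p X)‖)

/-- `M` is a slant submanifold with slant angle `θ`: the Wirtinger angle of a nonzero tangent
vector `X` at `p` is `θ`, independently of `p` and `X`. -/
def IsSlantWithAngle (J : Π x : N, TangentSpace I' x →L[ℝ] TangentSpace I' x) (f : M → N)
    (θ : ℝ) : Prop :=
  ∀ (p : M) (X : TangentSpace I p), X ≠ 0 → wirtingerAngle I I' J f p X = θ

variable [CompleteSpace E'] [IsManifold I' ∞ N]
  [IsContMDiffRiemannianBundle I' ∞ E' (fun x : N ↦ TangentSpace I' x)]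

/-- The covariant derivative of a vector field `V` along `f` (the connection on the pullback
bundle `f^* TN` induced by the Levi-Civita connection of `N`). If `V = ∑ Vᵏ ∂ₖ` in the coordinate
frame of the chart at `f p`, then `∇_u V = ∑ Vᵏ(p) ∇_{df u} ∂ₖ + ∑ dVᵏ(u) ∂ₖ` at `p`. The field
`∑ Vᵏ(p) ∂ₖ` with constant coordinates is `FiberBundle.extend E' (V p)`. -/
def covDerivAlong (f : M → N) (V : Π p : M, TangentSpace I' (f p)) (p : M)
    (u : TangentSpace I p) : TangentSpace I' (f p) :=
  leviCivita I' N (FiberBundle.extend E' (V p)) (f p) (mfderiv I I' f p u) +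
    (trivializationAt E' (TangentSpace I' : N → Type _) (f p)).symm (f p)
      (mvfderiv I (fun q ↦ (trivializationAt E' (TangentSpace I' : N → Type _) (f p)
        ⟨f q, V q⟩).2) p u)

variable [IsManifold I ∞ M]

/-- The second fundamental form `σ(u, v)` of `f` at `p`: the normal component of the covariant
derivative in the direction `u` of the vector field `df (V)` along `f`, where `V` is a vector
field of `M` near `p` with `V p = v`. -/
def secondFundamentalForm (f : M → N) (p : M) (u v : TangentSpace I p) : TangentSpace I' (f p) :=
  normalPart I I' f p
    (covDerivAlong I I' f (fun q ↦ mfderiv I I' f q (FiberBundle.extend E v q)) p u)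

/-- Every point of the submanifold is a geodesic point: the second fundamental form vanishes. -/
def IsTotallyGeodesic (f : M → N) : Prop :=
  ∀ (p : M) (u v : TangentSpace I p), secondFundamentalForm I I' f p u v = 0

variable [FiniteDimensional ℝ E] [RiemannianBundle (fun x : M ↦ TangentSpace I x)]

/-- The mean curvature vector `H = (1/n) trace σ`, the trace being the sum of `σ(eᵢ, eᵢ)` over an
orthonormal basis of `T_p M`. -/
def meanCurvature (f : M → N) (p : M) : TangentSpace I' (f p) :=
  (1 / (Module.finrank ℝ E : ℝ)) •
    ∑ i, secondFundamentalForm I I' f p (stdOrthonormalBasis ℝ (TangentSpace I p) i)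
      (stdOrthonormalBasis ℝ (TangentSpace I p) i)

/-- Every point of the submanifold is an umbilical point: `σ = g ⊗ H`. -/
def IsTotallyUmbilical (f : M → N) : Prop :=
  ∀ (p : M) (u v : TangentSpace I p),
    secondFundamentalForm I I' f p u v = (inner ℝ u v : ℝ) • meanCurvature I I' f p

end Submanifold

end SlantGeometry

end

noncomputable section

namespace SlantGeometry

set_option linter.unusedSectionVars false

/-! ### Calculus of real functions on a manifold. -/

section Along

variable {E : Type*} [NormedAddCommGroup E] [NormedSpace ℝ E]
  {H : Type*} [TopologicalSpace H] {I : ModelWithCorners ℝ E H}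
  {M : Type*} [TopologicalSpace M] [ChartedSpace H M]

/-! Umbilicity reduces the claim to `H = 0`. Write `P` for the tangential part of `J` on `T M` and
`c = cos θ`, so that `|P X| = c |X|` with `c < 1`. Then `J (T M)` meets `T M` only in zero, and by
dimension the two span the ambient tangent space (`eq_zero_of_inner_eq_zero`). As `H` is normal, it
suffices that `H ⟂ J (T M)`.

The input is the Gauss formula `∇_u V = (tangent) + g(u, V) H`, inserted into the derivative of `⟨J
V, W⟩`, which obeys a product rule because the Kaehler form is parallel (`IsParallelForm.along`,
`exists_mvfderiv_kaehlerForm`).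

If `c ≠ 0`, fix `v`, put `w = P v`, and extend both to tangent fields `V`, `W`. The function `c²
|V|² + |W|² - 2 ⟨J V, W⟩` equals `|P V - W|²`, so it has a minimum at `p` and its differential
vanishes there. In the direction `w` the tangential terms cancel, `g(w, v) = 0` kills one term in
`H`, and `g(w, w) ⟨J v, H⟩ = 0` remains, with `g(w, w) = c² |v|² ≠ 0`.

If `c = 0`, then `w = 0` and this gives nothing. Instead `⟨J U, W⟩` is identically zero;
differentiating it along a nonzero `u ⟂ w` leaves `g(u, u) ⟨J H, w⟩ = 0`. Such a `u` exists because
the dimension is at least two. -/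

theorem mvfderiv_eq_zero_of_isLocalMin [I.Boundaryless] {φ : M → ℝ} {p : M}
    (h : IsLocalMin φ p) : mvfderiv I φ p = 0 := by
  by_cases hd : MDiffAt φ p
  · rw [hd.mvfderiv, I.range_eq_univ, fderivWithin_univ]
    refine IsLocalMin.fderiv_eq_zero ?_
    have hc : ContinuousAt (extChartAt I p).symm (extChartAt I p p) :=
      continuousAt_extChartAt_symm p
    have ht : Filter.Tendsto (extChartAt I p).symm (nhds (extChartAt I p p)) (nhds p) := by
      simpa [ContinuousAt] using hc
    filter_upwards [ht.eventually h] with y hy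
    simpa [writtenInExtChartAt, chartAt_self_eq] using hy
  · ext v
    simp [mvfderiv, mfderiv_zero_of_not_mdifferentiableAt hd]

theorem mvfderiv_clm_comp {F G : Type*} [NormedAddCommGroup F] [NormedSpace ℝ F]
    [NormedAddCommGroup G] [NormedSpace ℝ G] (L : F →L[ℝ] G) {φ : M → F} {p : M}
    (h : MDiffAt φ p) : MDiffAt (fun q ↦ L (φ q)) p ∧
      ∀ u, mvfderiv I (fun q ↦ L (φ q)) p u = L (mvfderiv I φ p u) := by
  have h1 : HasMFDerivAt 𝓘(ℝ, F) 𝓘(ℝ, G) L (φ p) L := L.hasMFDerivAt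
  have h2 := h1.comp p h.hasMFDerivAt
  refine ⟨h2.mdifferentiableAt, fun u ↦ ?_⟩
  change mfderiv I 𝓘(ℝ, G) (L ∘ φ) p u = _
  rw [h2.mfderiv]
  rfl

theorem mvfderiv_finset_sum {ι : Type*} (s : Finset ι) {φ : ι → M → ℝ} {p : M}
    (h : ∀ i ∈ s, MDiffAt (φ i) p) : MDiffAt (fun q ↦ ∑ i ∈ s, φ i q) p ∧
      mvfderiv I (fun q ↦ ∑ i ∈ s, φ i q) p = ∑ i ∈ s, mvfderiv I (φ i) p := by
  classical
  induction s using Finset.induction_on with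
  | empty => exact ⟨by simpa using mdifferentiableAt_const, by simp [mvfderiv_const]⟩
  | insert a s ha ih =>
    have h1 := h a (Finset.mem_insert_self a s)
    have h2 := ih fun i hi ↦ h i (Finset.mem_insert_of_mem hi)
    simp only [Finset.sum_insert ha]
    refine ⟨h1.add h2.1, ?_⟩
    rw [mvfderiv_fun_add h1 h2.1, h2.2]

theorem mvfderiv_congr {φ ψ : M → ℝ} {p : M} (h : φ =ᶠ[nhds p] ψ) :
    mvfderiv I φ p = mvfderiv I ψ p := by
  have := h.mfderiv_eq (I := I) (I' := 𝓘(ℝ, ℝ))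
  exact this

theorem bilinear_sum_smul {V ι : Type*} [AddCommGroup V] [Module ℝ V] [Fintype ι]
    (B : V →ₗ[ℝ] V →ₗ[ℝ] ℝ) (a b : ι → ℝ) (x y : ι → V) :
    B (∑ k, a k • x k) (∑ l, b l • y l) = ∑ k, ∑ l, a k * (b l * B (x k) (y l)) := by
  simp only [map_sum, LinearMap.sum_apply, map_smul, LinearMap.smul_apply, smul_eq_mul,
    Finset.mul_sum]
  rw [Finset.sum_comm]
  exact Finset.sum_congr rfl fun k _ ↦ Finset.sum_congr rfl fun l _ ↦ by ring

/-! ### Coordinate frames and the product rule along a map. -/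

variable {E' : Type*} [NormedAddCommGroup E'] [NormedSpace ℝ E'] [FiniteDimensional ℝ E']
  {H' : Type*} [TopologicalSpace H'] {I' : ModelWithCorners ℝ E' H'}
  {N : Type*} [TopologicalSpace N] [ChartedSpace H' N] [IsManifold I' ∞ N]

variable (I') in
/-- The coordinate vector fields at `y₀`. -/
def frame (y₀ : N) (k : Fin (Module.finrank ℝ E')) (y : N) : TangentSpace I' y :=
  (trivializationAt E' (TangentSpace I' : N → Type _) y₀).symm y (Module.finBasis ℝ E' k)

variable (I') in
/-- The coordinates, in the coordinate frame at `y₀`, of a tangent vector. -/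
def frameCoord (y₀ : N) (k : Fin (Module.finrank ℝ E')) (w : TangentBundle I' N) : ℝ :=
  (Module.finBasis ℝ E').coord k (trivializationAt E' (TangentSpace I' : N → Type _) y₀ w).2

theorem symm_eq_sum_frame {y₀ y : N}
    (hy : y ∈ (trivializationAt E' (TangentSpace I' : N → Type _) y₀).baseSet) (e : E') :
    (trivializationAt E' (TangentSpace I' : N → Type _) y₀).symm y e =
      ∑ k, (Module.finBasis ℝ E').coord k e • frame I' y₀ k y := by
  have h := (trivializationAt E' (TangentSpace I' : N → Type _) y₀).coe_symmₗ (R := ℝ) hy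
  simp only [frame]
  rw [← h]
  have hs := (Module.finBasis ℝ E').sum_repr e
  have hm := congrArg
    ((trivializationAt E' (TangentSpace I' : N → Type _) y₀).symmₗ ℝ y) hs
  rw [map_sum] at hm
  simpa only [map_smul, Module.Basis.coord_apply] using hm.symm

theorem eq_sum_frame {y₀ y : N}
    (hy : y ∈ (trivializationAt E' (TangentSpace I' : N → Type _) y₀).baseSet)
    (w : TangentSpace I' y) :
    w = ∑ k, frameCoord I' y₀ k ⟨y, w⟩ • frame I' y₀ k y := by
  have h := symm_eq_sum_frame hy
    (trivializationAt E' (TangentSpace I' : N → Type _) y₀ ⟨y, w⟩).2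
  rwa [Trivialization.symm_apply_apply_mk _ hy w] at h

theorem mdifferentiableAt_frame (y₀ : N) (k : Fin (Module.finrank ℝ E')) :
    MDiffAt (T% (frame I' y₀ k)) y₀ := by
  have hy := FiberBundle.mem_baseSet_trivializationAt' (F := E') (E := (TangentSpace I' : N → Type _)) y₀
  -- Both fields have constant coordinates in the trivialization at `y₀`.
  have : frame I' y₀ k = FiberBundle.extend E' (frame I' y₀ k y₀) := by
    ext y
    simp [frame, FiberBundle.extend, Trivialization.apply_mk_symm _ hy]
  rw [this]
  exact FiberBundle.mdifferentiableAt_extend ..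

theorem cov_sum_smul (cov : CovariantDerivative I' E' (fun x : N ↦ TangentSpace I' x))
    {ι : Type*} (s : Finset ι) (a : ι → ℝ) {S : ι → Π y : N, TangentSpace I' y} {y₀ : N}
    (h : ∀ k, MDiffAt (T% (S k)) y₀) :
    cov (∑ k ∈ s, a k • S k) y₀ = ∑ k ∈ s, a k • cov (S k) y₀ := by
  classical
  have hs : ∀ k, MDiffAt (T% (a k • S k)) y₀ := fun k ↦ (h k).smul_const_section
  have hsum : ∀ t : Finset ι, MDiffAt (T% (∑ k ∈ t, a k • S k)) y₀ := fun t ↦ by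
    have := MDifferentiableAt.sum_section (s := t) (t := fun k ↦ a k • S k) (x₀ := y₀)
      (fun k _ ↦ hs k)
    convert! this using 3
    simp
  induction s using Finset.induction_on with
  | empty => simp
  | insert i s hi ih =>
    rw [Finset.sum_insert hi, Finset.sum_insert hi,
      cov.isCovariantDerivativeOn.add (hs i) (hsum s) (Set.mem_univ _), ih,
      cov.isCovariantDerivativeOn.smul_const (a i) (h i) (Set.mem_univ _)]

/-- Near `y₀` the constant-coordinate extension is a combination of the frame fields with constant
coefficients, and a covariant derivative depends only on germs. -/
theorem cov_extend (cov : CovariantDerivative I' E' (fun x : N ↦ TangentSpace I' x))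
    {y₀ : N} (w : TangentSpace I' y₀) :
    cov (FiberBundle.extend E' w) y₀ = ∑ k, frameCoord I' y₀ k ⟨y₀, w⟩ • cov (frame I' y₀ k) y₀ := by
  rw [← cov_sum_smul cov Finset.univ _ (mdifferentiableAt_frame y₀)]
  have hev : ∀ᶠ y in nhds y₀, FiberBundle.extend E' w y =
      (∑ k, frameCoord I' y₀ k ⟨y₀, w⟩ • frame I' y₀ k) y := by
    filter_upwards [(trivializationAt E' (TangentSpace I' : N → Type _) y₀).open_baseSet.mem_nhds
      (FiberBundle.mem_baseSet_trivializationAt' y₀)] with y hy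
    rw [FiberBundle.extend, symm_eq_sum_frame hy]
    simp [frameCoord]
  have hd : MDiffAt (T% (FiberBundle.extend E' w : Π y : N, TangentSpace I' y)) y₀ :=
    FiberBundle.mdifferentiableAt_extend ..
  refine cov.isCovariantDerivativeOn.congr_of_eventuallyEq hd ?_ Filter.univ_mem hev
  refine hd.congr_of_eventuallyEq ?_
  filter_upwards [hev] with y hy
  rw [hy]

variable [RiemannianBundle (fun x : N ↦ TangentSpace I' x)]
  [IsContMDiffRiemannianBundle I' ∞ E' (fun x : N ↦ TangentSpace I' x)] [CompleteSpace E']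

theorem mdifferentiableAt_frameCoord {f : M → N} {V : Π p : M, TangentSpace I' (f p)} {p : M}
    (hV : MDiffAt (fun q ↦ (⟨f q, V q⟩ : TangentBundle I' N)) p)
    (k : Fin (Module.finrank ℝ E')) :
    MDiffAt (fun q ↦ frameCoord I' (f p) k ⟨f q, V q⟩) p :=
  (mvfderiv_clm_comp (LinearMap.toContinuousLinearMap ((Module.finBasis ℝ E').coord k))
    ((mdifferentiableAt_totalSpace _ _).1 hV).2).1

/-- All dependence on `V` now sits in scalar functions on `M`, so the Leibniz rule along `f` becomes
the ordinary one for products of functions. -/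
theorem covDerivAlong_eq_sum {f : M → N} {V : Π p : M, TangentSpace I' (f p)} {p : M}
    (hV : MDiffAt (fun q ↦ (⟨f q, V q⟩ : TangentBundle I' N)) p) (u : TangentSpace I p) :
    covDerivAlong I I' f V p u =
      ∑ k, (frameCoord I' (f p) k ⟨f p, V p⟩ •
          leviCivita I' N (frame I' (f p) k) (f p) (mfderiv I I' f p u) +
        mvfderiv I (fun q ↦ frameCoord I' (f p) k ⟨f q, V q⟩) p u • frame I' (f p) k (f p)) := by
  have hy := FiberBundle.mem_baseSet_trivializationAt' (F := E')
    (E := (TangentSpace I' : N → Type _)) (f p)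
  rw [covDerivAlong, cov_extend, symm_eq_sum_frame hy, Finset.sum_add_distrib]
  congr 1
  · simp
  · refine Finset.sum_congr rfl fun k _ ↦ ?_
    congr 1
    exact ((mvfderiv_clm_comp (LinearMap.toContinuousLinearMap ((Module.finBasis ℝ E').coord k))
      ((mdifferentiableAt_totalSpace _ _).1 hV).2).2 u).symm

/-- A field of bilinear forms which is parallel for the Levi-Civita connection. -/
def IsParallelForm (β : Π y : N, TangentSpace I' y →ₗ[ℝ] TangentSpace I' y →ₗ[ℝ] ℝ) : Prop :=
  ∀ (y : N) (Y Z : Π y : N, TangentSpace I' y), MDiffAt (T% Y) y → MDiffAt (T% Z) y →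
    MDiffAt (fun z ↦ β z (Y z) (Z z)) y ∧
      ∀ v, mvfderiv I' (fun z ↦ β z (Y z) (Z z)) y v =
        β y (leviCivita I' N Y y v) (Z y) + β y (Y y) (leviCivita I' N Z y v)

/-- Expand `V` and `W` in the frame at `f p`: the coefficients `β (S k) (S l)` are functions on `N`,
differentiated by parallelism and the chain rule, while the coordinates are functions on `M`. -/
theorem IsParallelForm.along
    {β : Π y : N, TangentSpace I' y →ₗ[ℝ] TangentSpace I' y →ₗ[ℝ] ℝ} (hβ : IsParallelForm β)
    {f : M → N} {V W : Π p : M, TangentSpace I' (f p)} {p : M}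
    (hV : MDiffAt (fun q ↦ (⟨f q, V q⟩ : TangentBundle I' N)) p)
    (hW : MDiffAt (fun q ↦ (⟨f q, W q⟩ : TangentBundle I' N)) p) :
    MDiffAt (fun q ↦ β (f q) (V q) (W q)) p ∧
      ∀ u, mvfderiv I (fun q ↦ β (f q) (V q) (W q)) p u =
        β (f p) (covDerivAlong I I' f V p u) (W p) +
          β (f p) (V p) (covDerivAlong I I' f W p u) := by
  have hf : MDiffAt f p := ((mdifferentiableAt_totalSpace _ _).1 hV).1
  have hy := FiberBundle.mem_baseSet_trivializationAt' (F := E')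
    (E := (TangentSpace I' : N → Type _)) (f p)
  let S := frame I' (f p)
  let a := fun k q ↦ frameCoord I' (f p) k ⟨f q, V q⟩
  let b := fun k q ↦ frameCoord I' (f p) k ⟨f q, W q⟩
  have ha : ∀ k, MDiffAt (a k) p := mdifferentiableAt_frameCoord hV
  have hb : ∀ k, MDiffAt (b k) p := mdifferentiableAt_frameCoord hW
  have hS := fun k l ↦ hβ (f p) (S k) (S l) (mdifferentiableAt_frame _ _)
    (mdifferentiableAt_frame _ _)
  let G := fun k l y ↦ β y (S k y) (S l y)
  have hG : ∀ k l, MDiffAt (fun q ↦ G k l (f q)) p := fun k l ↦ (hS k l).1.comp p hf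
  have hG' : ∀ k l u, mvfderiv I (fun q ↦ G k l (f q)) p u =
      mvfderiv I' (G k l) (f p) (mfderiv I I' f p u) := fun k l u ↦
    mvfderiv_comp_apply p (hS k l).1 hf u
  -- The frame spans only over the trivialization domain, so the expansion holds only near `p`; that
  -- suffices for the derivative.
  have hev : (fun q ↦ β (f q) (V q) (W q)) =ᶠ[nhds p]
      fun q ↦ ∑ k, ∑ l, a k q * (b l q * G k l (f q)) := by
    have := hf.continuousAt.preimage_mem_nhds
      ((trivializationAt E' (TangentSpace I' : N → Type _) (f p)).open_baseSet.mem_nhds hy)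
    filter_upwards [this] with q hq
    conv_lhs => rw [eq_sum_frame hq (V q), eq_sum_frame hq (W q)]
    exact bilinear_sum_smul _ _ _ _ _
  have hbG : ∀ k l, MDiffAt (fun q ↦ b l q * G k l (f q)) p := fun k l ↦ (hb l).mul (hG k l)
  have habG := fun k l ↦ (ha k).mul (hbG k l)
  have hin := fun k ↦ mvfderiv_finset_sum Finset.univ
    (φ := fun l q ↦ a k q * (b l q * G k l (f q))) fun l _ ↦ habG k l
  have hout := mvfderiv_finset_sum Finset.univ
    (φ := fun k q ↦ ∑ l, a k q * (b l q * G k l (f q))) fun k _ ↦ (hin k).1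
  refine ⟨hout.1.congr_of_eventuallyEq hev, fun u ↦ ?_⟩
  rw [mvfderiv_congr hev, hout.2, sum_apply]
  simp only [(hin _).2, sum_apply]
  -- The four summands match the four bilinear expansions obtained from `hDV` and `hDW`.
  have hterm : ∀ k l, mvfderiv I (fun q ↦ a k q * (b l q * G k l (f q))) p u =
      a k p * (b l p * β (f p) (leviCivita I' N (S k) (f p) (mfderiv I I' f p u)) (S l (f p))) +
      a k p * (b l p * β (f p) (S k (f p)) (leviCivita I' N (S l) (f p) (mfderiv I I' f p u))) +
      mvfderiv I (a k) p u * (b l p * β (f p) (S k (f p)) (S l (f p))) +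
      a k p * (mvfderiv I (b l) p u * β (f p) (S k (f p)) (S l (f p))) := fun k l ↦ by
    rw [mvfderiv_fun_mul (ha k) (hbG k l), mvfderiv_fun_mul (hb l) (hG k l)]
    simp only [add_apply, smul_apply, smul_eq_mul, hG', G, (hS k l).2]
    ring
  have hV' : V p = ∑ k, a k p • S k (f p) := eq_sum_frame hy (V p)
  have hW' : W p = ∑ k, b k p • S k (f p) := eq_sum_frame hy (W p)
  have hDV : covDerivAlong I I' f V p u =
      ∑ k, a k p • leviCivita I' N (S k) (f p) (mfderiv I I' f p u) +
        ∑ k, mvfderiv I (a k) p u • S k (f p) := by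
    rw [covDerivAlong_eq_sum hV, Finset.sum_add_distrib]
  have hDW : covDerivAlong I I' f W p u =
      ∑ k, b k p • leviCivita I' N (S k) (f p) (mfderiv I I' f p u) +
        ∑ k, mvfderiv I (b k) p u • S k (f p) := by
    rw [covDerivAlong_eq_sum hW, Finset.sum_add_distrib]
  rw [hDV, hDW, hV', hW', map_add, LinearMap.add_apply, map_add, bilinear_sum_smul,
    bilinear_sum_smul, bilinear_sum_smul, bilinear_sum_smul]
  simp only [hterm, Finset.sum_add_distrib]
  ring

end Along

/-! ### Parallelism of the metric and of the Kaehler form. -/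

section KaehlerForms

variable {E' : Type*} [NormedAddCommGroup E'] [NormedSpace ℝ E'] [FiniteDimensional ℝ E']
  [CompleteSpace E'] {H' : Type*} [TopologicalSpace H'] {I' : ModelWithCorners ℝ E' H'}
  {N : Type*} [TopologicalSpace N] [ChartedSpace H' N] [IsManifold I' ∞ N]
  [RiemannianBundle (fun x : N ↦ TangentSpace I' x)]
  [IsContMDiffRiemannianBundle I' ∞ E' (fun x : N ↦ TangentSpace I' x)]

theorem mvfderiv_inner_leviCivita {y : N} {Y Z : Π y : N, TangentSpace I' y}
    (hY : MDiffAt (T% Y) y) (hZ : MDiffAt (T% Z) y) (v : TangentSpace I' y) :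
    mvfderiv I' (fun z ↦ inner ℝ (Y z) (Z z)) y v =
      inner ℝ (leviCivita I' N Y y v) (Z y) + inner ℝ (Y y) (leviCivita I' N Z y v) := by
  have h := (exists_leviCivita I' N).choose_spec.1.mvfderiv_inner_eq
    (FiberBundle.extend E' v) hY hZ
  simp only [FiberBundle.extend_apply_self] at h
  exact h

variable (I' N) in
theorem isParallelForm_inner :
    IsParallelForm (I' := I') (fun y : N ↦ innerₗ (TangentSpace I' y)) := fun _ _ _ hY hZ ↦
  ⟨mdifferentiableAt_inner hY hZ, mvfderiv_inner_leviCivita hY hZ⟩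

variable {J : Π x : N, TangentSpace I' x →L[ℝ] TangentSpace I' x}

theorem IsKaehler.mdifferentiableAt (hJ : IsKaehler I' J) {y : N}
    {Y : Π y : N, TangentSpace I' y} (hY : MDiffAt (T% Y) y) :
    MDiffAt (T% (fun z ↦ J z (Y z))) y :=
  MDifferentiableAt.clm_bundle_apply ((hJ.contMDiff y).mdifferentiableAt (by simp)) hY

/-- Metric compatibility applied to `J Y` and `Z`, with `∇ (J Y) = J ∇ Y`. -/
theorem IsKaehler.isParallelForm (hJ : IsKaehler I' J) :
    IsParallelForm (I' := I') (fun y : N ↦ innerₗ (TangentSpace I' y) ∘ₗ (J y).toLinearMap) :=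
  fun y Y Z hY hZ ↦ ⟨mdifferentiableAt_inner (hJ.mdifferentiableAt hY) hZ, fun v ↦ by
    have h := mvfderiv_inner_leviCivita (hJ.mdifferentiableAt hY) hZ v
    rw [hJ.parallel y Y hY v] at h
    exact h⟩

theorem IsKaehler.inner_map_left (hJ : IsKaehler I' J) (y : N) (v w : TangentSpace I' y) :
    inner ℝ (J y v) w = -inner ℝ v (J y w) := by
  have h := hJ.inner_map_map y v (J y w)
  rw [hJ.sq_eq_neg, inner_neg_right] at h
  linarith

theorem IsKaehler.norm_map (hJ : IsKaehler I' J) (y : N) (v : TangentSpace I' y) :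
    ‖J y v‖ = ‖v‖ := by
  have h := hJ.inner_map_map y v v
  rw [real_inner_self_eq_norm_sq, real_inner_self_eq_norm_sq] at h
  exact (pow_left_inj₀ (norm_nonneg _) (norm_nonneg _) two_ne_zero).1 h

end KaehlerForms

/-! ### Tangential and normal parts, and the slant condition as a norm identity. -/

section Immersion

variable {E : Type*} [NormedAddCommGroup E] [NormedSpace ℝ E]
  {H : Type*} [TopologicalSpace H] {I : ModelWithCorners ℝ E H}
  {M : Type*} [TopologicalSpace M] [ChartedSpace H M] [IsManifold I ∞ M]
  {E' : Type*} [NormedAddCommGroup E'] [NormedSpace ℝ E']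
  {H' : Type*} [TopologicalSpace H'] {I' : ModelWithCorners ℝ E' H'}
  {N : Type*} [TopologicalSpace N] [ChartedSpace H' N] [IsManifold I' ∞ N]
  {f : M → N}

theorem mdifferentiableAt_pushforward (hf : ContMDiff I I' ∞ f) {Y : Π p : M, TangentSpace I p}
    {p : M} (hY : MDiffAt (T% Y) p) :
    MDiffAt (fun q ↦ (⟨f q, mfderiv I I' f q (Y q)⟩ : TangentBundle I' N)) p := by
  have h : MDifferentiable I.tangent I'.tangent (tangentMap I I' f) :=
    (hf.contMDiff_tangentMap (m := ∞) le_rfl).mdifferentiable (by simp)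
  exact (h _).comp p hY

variable [RiemannianBundle (fun x : N ↦ TangentSpace I' x)] [FiniteDimensional ℝ E']

theorem tangentialPart_mem (p : M) (w : TangentSpace I' (f p)) :
    tangentialPart I I' f p w ∈ LinearMap.range (mfderiv I I' f p).toLinearMap :=
  Submodule.starProjection_apply_mem _ _

theorem inner_normalPart {p : M} (w : TangentSpace I' (f p)) {x : TangentSpace I' (f p)}
    (hx : x ∈ LinearMap.range (mfderiv I I' f p).toLinearMap) :
    inner ℝ (normalPart I I' f p w) x = 0 :=
  Submodule.starProjection_inner_eq_zero _ _ hx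

theorem inner_tangentialPart {p : M} (w : TangentSpace I' (f p)) {x : TangentSpace I' (f p)}
    (hx : x ∈ LinearMap.range (mfderiv I I' f p).toLinearMap) :
    inner ℝ (tangentialPart I I' f p w) x = inner ℝ w x := by
  have h := inner_normalPart w hx
  rw [normalPart, inner_sub_left] at h
  linarith

variable [IsContMDiffRiemannianBundle I' ∞ E' (fun x : N ↦ TangentSpace I' x)]
  [CompleteSpace E'] [FiniteDimensional ℝ E] [RiemannianBundle (fun x : M ↦ TangentSpace I x)]

theorem inner_meanCurvature {p : M} {x : TangentSpace I' (f p)}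
    (hx : x ∈ LinearMap.range (mfderiv I I' f p).toLinearMap) :
    inner ℝ (meanCurvature I I' f p) x = 0 := by
  rw [meanCurvature, real_inner_smul_left, sum_inner, Finset.sum_eq_zero, mul_zero]
  exact fun i _ ↦ inner_normalPart _ hx

/-- The Gauss formula of a totally umbilical submanifold. -/
theorem IsTotallyUmbilical.exists_covDerivAlong_eq (humb : IsTotallyUmbilical I I' f) (p : M)
    (u v : TangentSpace I p) :
    ∃ x ∈ LinearMap.range (mfderiv I I' f p).toLinearMap,
      covDerivAlong I I' f (fun q ↦ mfderiv I I' f q (FiberBundle.extend E v q)) p u =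
        x + (inner ℝ u v : ℝ) • meanCurvature I I' f p := by
  refine ⟨_, tangentialPart_mem p (covDerivAlong I I' f
    (fun q ↦ mfderiv I I' f q (FiberBundle.extend E v q)) p u), ?_⟩
  rw [← humb p u v, secondFundamentalForm, normalPart]
  abel

theorem IsIsometricImmersion.injective_mfderiv (hf : IsIsometricImmersion I I' f) (p : M) :
    Function.Injective (mfderiv I I' f p) := by
  rw [injective_iff_map_eq_zero]
  intro v hv
  have h := hf.inner_mfderiv p v v
  rw [hv, inner_zero_left] at h
  exact inner_self_eq_zero.1 h.symm

variable {J : Π x : N, TangentSpace I' x →L[ℝ] TangentSpace I' x}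

/-- The angle is the arccosine of a nonnegative number, hence lies in `[0, π/2]`, where the cosine
is strictly decreasing. A nonzero `X` is needed for the slant condition to constrain `θ`. -/
theorem IsSlantWithAngle.cos_nonneg_lt_one {θ : ℝ} (hslant : IsSlantWithAngle I I' J f θ)
    (hθ : θ ≠ 0) {p : M} {X : TangentSpace I p} (hX : X ≠ 0) :
    0 ≤ Real.cos θ ∧ Real.cos θ < 1 := by
  have h := hslant p X hX
  rw [wirtingerAngle] at h
  have h0 : 0 ≤ ‖tangentialPart I I' f p (J (f p) (mfderiv I I' f p X))‖ /
    ‖J (f p) (mfderiv I I' f p X)‖ := by positivity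
  have h1 : θ ≤ Real.pi / 2 := h ▸ Real.arccos_le_pi_div_two.2 h0
  have h2 : 0 ≤ θ := h ▸ Real.arccos_nonneg _
  refine ⟨Real.cos_nonneg_of_neg_pi_div_two_le_of_le (by linarith [Real.pi_pos]) h1, ?_⟩
  rw [← Real.cos_zero]
  exact Real.cos_lt_cos_of_nonneg_of_le_pi_div_two le_rfl h1 (lt_of_le_of_ne h2 hθ.symm)

theorem IsSlantWithAngle.norm_tangentialPart {θ : ℝ} (hslant : IsSlantWithAngle I I' J f θ)
    (hJ : IsKaehler I' J) {p : M} {x : TangentSpace I' (f p)}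
    (hx : x ∈ LinearMap.range (mfderiv I I' f p).toLinearMap) :
    ‖tangentialPart I I' f p (J (f p) x)‖ = Real.cos θ * ‖x‖ := by
  obtain ⟨X, rfl⟩ := hx
  by_cases hX : mfderiv I I' f p X = 0
  · have hX' : (mfderiv I I' f p).toLinearMap X = 0 := hX
    simp [hX', tangentialPart]
  have hX0 : X ≠ 0 := by rintro rfl; simp at hX
  have hn : 0 < ‖mfderiv I I' f p X‖ := norm_pos_iff.2 hX
  have h := hslant p X hX0
  rw [wirtingerAngle, hJ.norm_map] at h
  have hle : ‖tangentialPart I I' f p (J (f p) (mfderiv I I' f p X))‖ ≤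
      ‖mfderiv I I' f p X‖ := by
    rw [← hJ.norm_map (f p) (mfderiv I I' f p X)]
    exact (LinearMap.range (mfderiv I I' f p).toLinearMap).norm_starProjection_apply_le _
  change ‖tangentialPart I I' f p (J (f p) (mfderiv I I' f p X))‖ =
    Real.cos θ * ‖mfderiv I I' f p X‖
  have h0 : 0 ≤ ‖tangentialPart I I' f p (J (f p) (mfderiv I I' f p X))‖ /
    ‖mfderiv I I' f p X‖ := by positivity
  -- `Real.arccos` truncates outside `[-1, 1]`; the ratio is at most `1` because `J` is isometric
  -- and projection contracts.
  rw [← h, Real.cos_arccos (by linarith) ((div_le_one hn).2 hle)]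
  field_simp

end Immersion

/-! ### Tangent fields along the immersion. -/

section Umbilical

variable {E : Type*} [NormedAddCommGroup E] [NormedSpace ℝ E] [FiniteDimensional ℝ E]
  {H : Type*} [TopologicalSpace H] {I : ModelWithCorners ℝ E H}
  {M : Type*} [TopologicalSpace M] [ChartedSpace H M] [IsManifold I ∞ M]
  [RiemannianBundle (fun x : M ↦ TangentSpace I x)]
  {E' : Type*} [NormedAddCommGroup E'] [NormedSpace ℝ E'] [FiniteDimensional ℝ E']
  [CompleteSpace E']
  {H' : Type*} [TopologicalSpace H'] {I' : ModelWithCorners ℝ E' H'}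
  {N : Type*} [TopologicalSpace N] [ChartedSpace H' N] [IsManifold I' ∞ N]
  [RiemannianBundle (fun x : N ↦ TangentSpace I' x)]
  [IsContMDiffRiemannianBundle I' ∞ E' (fun x : N ↦ TangentSpace I' x)]
  {f : M → N} {J : Π x : N, TangentSpace I' x →L[ℝ] TangentSpace I' x}

variable (I I') in
/-- The tangent vector field along `f` obtained by extending `v` and pushing forward. -/
def pushExtend (f : M → N) {p : M} (v : TangentSpace I p) (q : M) : TangentSpace I' (f q) :=
  mfderiv I I' f q (FiberBundle.extend E v q)

@[simp]
theorem pushExtend_self {p : M} (v : TangentSpace I p) :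
    pushExtend I I' f v p = mfderiv I I' f p v := by
  simp [pushExtend]

theorem pushExtend_mem {p : M} (v : TangentSpace I p) (q : M) :
    pushExtend I I' f v q ∈ LinearMap.range (mfderiv I I' f q).toLinearMap :=
  ⟨_, rfl⟩

theorem mdifferentiableAt_pushExtend (hf : ContMDiff I I' ∞ f) {p : M} (v : TangentSpace I p) :
    MDiffAt (fun q ↦ (⟨f q, pushExtend I I' f v q⟩ : TangentBundle I' N)) p :=
  mdifferentiableAt_pushforward hf (FiberBundle.mdifferentiableAt_extend ..)

/-- Polarization of the norm identity. -/
theorem inner_tangentialPart_tangentialPart {p : M} {c : ℝ}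
    (hP : ∀ x ∈ LinearMap.range (mfderiv I I' f p).toLinearMap,
      ‖tangentialPart I I' f p (J (f p) x)‖ = c * ‖x‖)
    {x y : TangentSpace I' (f p)} (hx : x ∈ LinearMap.range (mfderiv I I' f p).toLinearMap)
    (hy : y ∈ LinearMap.range (mfderiv I I' f p).toLinearMap) :
    inner ℝ (tangentialPart I I' f p (J (f p) x)) (tangentialPart I I' f p (J (f p) y)) =
      c ^ 2 * inner ℝ x y := by
  have hadd : tangentialPart I I' f p (J (f p) (x + y)) =
      tangentialPart I I' f p (J (f p) x) + tangentialPart I I' f p (J (f p) y) := by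
    simp [tangentialPart]
  have h := congrArg (· ^ 2) (hP (x + y) (Submodule.add_mem _ hx hy))
  have h1 := congrArg (· ^ 2) (hP x hx)
  have h2 := congrArg (· ^ 2) (hP y hy)
  simp only [hadd, mul_pow, norm_add_sq_real] at h h1 h2
  linarith

/-! ### Orthogonality of the mean curvature to `J (T M)`, and the conclusion. -/

variable [I.Boundaryless]

/-- The derivative of `⟨J df(v), df(w)⟩` along a totally umbilical submanifold. -/
theorem exists_mvfderiv_kaehlerForm (hJ : IsKaehler I' J) (hf : ContMDiff I I' ∞ f)
    (humb : IsTotallyUmbilical I I' f) {p : M} (u v w : TangentSpace I p) :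
    ∃ x ∈ LinearMap.range (mfderiv I I' f p).toLinearMap,
    ∃ y ∈ LinearMap.range (mfderiv I I' f p).toLinearMap,
      (mvfderiv I (fun q ↦ inner ℝ (J (f q) (pushExtend I I' f v q)) (pushExtend I I' f w q)) p u =
        inner ℝ (J (f p) x) (mfderiv I I' f p w) + inner ℝ (J (f p) (mfderiv I I' f p v)) y +
        (inner ℝ u v * inner ℝ (J (f p) (meanCurvature I I' f p)) (mfderiv I I' f p w) +
          inner ℝ u w * inner ℝ (J (f p) (mfderiv I I' f p v)) (meanCurvature I I' f p))) ∧
      mvfderiv I (fun q ↦ inner ℝ (pushExtend I I' f v q) (pushExtend I I' f v q)) p u =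
        2 * inner ℝ x (mfderiv I I' f p v) ∧
      mvfderiv I (fun q ↦ inner ℝ (pushExtend I I' f w q) (pushExtend I I' f w q)) p u =
        2 * inner ℝ y (mfderiv I I' f p w) := by
  obtain ⟨x, hx, hx'⟩ := humb.exists_covDerivAlong_eq p u v
  obtain ⟨y, hy, hy'⟩ := humb.exists_covDerivAlong_eq p u w
  have hV := mdifferentiableAt_pushExtend (I' := I') hf v
  have hW := mdifferentiableAt_pushExtend (I' := I') hf w
  have h1 : mvfderiv I
      (fun q ↦ inner ℝ (J (f q) (pushExtend I I' f v q)) (pushExtend I I' f w q)) p u =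
      inner ℝ (J (f p) (covDerivAlong I I' f (pushExtend I I' f v) p u)) (pushExtend I I' f w p) +
      inner ℝ (J (f p) (pushExtend I I' f v p)) (covDerivAlong I I' f (pushExtend I I' f w) p u) :=
    (hJ.isParallelForm.along hV hW).2 u
  have h2 : mvfderiv I (fun q ↦ inner ℝ (pushExtend I I' f v q) (pushExtend I I' f v q)) p u =
      inner ℝ (covDerivAlong I I' f (pushExtend I I' f v) p u) (pushExtend I I' f v p) +
      inner ℝ (pushExtend I I' f v p) (covDerivAlong I I' f (pushExtend I I' f v) p u) :=
    ((isParallelForm_inner I' N).along hV hV).2 u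
  have h3 : mvfderiv I (fun q ↦ inner ℝ (pushExtend I I' f w q) (pushExtend I I' f w q)) p u =
      inner ℝ (covDerivAlong I I' f (pushExtend I I' f w) p u) (pushExtend I I' f w p) +
      inner ℝ (pushExtend I I' f w p) (covDerivAlong I I' f (pushExtend I I' f w) p u) :=
    ((isParallelForm_inner I' N).along hW hW).2 u
  change covDerivAlong I I' f (pushExtend I I' f v) p u = _ at hx'
  change covDerivAlong I I' f (pushExtend I I' f w) p u = _ at hy'
  rw [hx', hy'] at h1
  rw [hx'] at h2
  rw [hy'] at h3
  simp only [pushExtend_self, map_add, map_smul, inner_add_left, inner_add_right, real_inner_smul_left,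
    real_inner_smul_right] at h1 h2 h3
  have hv := inner_meanCurvature (I := I) (I' := I') (f := f)
    (x := mfderiv I I' f p v) ⟨v, rfl⟩
  have hw := inner_meanCurvature (I := I) (I' := I') (f := f)
    (x := mfderiv I I' f p w) ⟨w, rfl⟩
  refine ⟨x, hx, y, hy, ?_, ?_, ?_⟩
  · rw [h1]; ring
  · rw [h2, real_inner_comm x, real_inner_comm (meanCurvature I I' f p), hv]; ring
  · rw [h3, real_inner_comm y, real_inner_comm (meanCurvature I I' f p), hw]; ring

/-- If `c ≠ 0`, the tangential part of `J` has constant length `c`, and `f` is totally umbilical,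
then the mean curvature vector is orthogonal to `J (T M)`. -/
theorem inner_meanCurvature_of_ne_zero (hJ : IsKaehler I' J) (hf : IsIsometricImmersion I I' f)
    (humb : IsTotallyUmbilical I I' f) {c : ℝ} (hc : c ≠ 0)
    (hP : ∀ q, ∀ x ∈ LinearMap.range (mfderiv I I' f q).toLinearMap,
      ‖tangentialPart I I' f q (J (f q) x)‖ = c * ‖x‖) {p : M} (v : TangentSpace I p) :
    inner ℝ (J (f p) (mfderiv I I' f p v)) (meanCurvature I I' f p) = 0 := by
  obtain ⟨w, hw⟩ := tangentialPart_mem (I := I) p (J (f p) (mfderiv I I' f p v))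
  replace hw : mfderiv I I' f p w = tangentialPart I I' f p (J (f p) (mfderiv I I' f p v)) := hw
  by_cases hv0 : v = 0
  · simp [hv0]
  have hvm : mfderiv I I' f p v ∈ LinearMap.range (mfderiv I I' f p).toLinearMap := ⟨v, rfl⟩
  have hwm : mfderiv I I' f p w ∈ LinearMap.range (mfderiv I I' f p).toLinearMap := ⟨w, rfl⟩
  let V := pushExtend I I' f v
  -- `W` agrees with the tangential part of `J V` at `p` but need not do so elsewhere, so no
  -- differentiability of that tangential part is required.
  let W := pushExtend I I' f w
  have hV := mdifferentiableAt_pushExtend (I' := I') hf.contMDiff v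
  have hW := mdifferentiableAt_pushExtend (I' := I') hf.contMDiff w
  have d1 := (hJ.isParallelForm.along hV hW).1
  have d2 := ((isParallelForm_inner I' N).along hV hV).1
  have d3 := ((isParallelForm_inner I' N).along hW hW).1
  simp only [LinearMap.comp_apply, ContinuousLinearMap.coe_coe, innerₗ_apply_apply] at d1 d2 d3
  have hww : inner ℝ (mfderiv I I' f p w) (mfderiv I I' f p w) =
      c ^ 2 * inner ℝ (mfderiv I I' f p v) (mfderiv I I' f p v) := by
    rw [hw, inner_tangentialPart_tangentialPart (hP p) hvm hvm]
  -- This is `‖P V - W‖²`, with `P V` the tangential part of `J V`, expanded into pairings whose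
  -- derivatives are known.
  let φ : M → ℝ := fun q ↦ (c ^ 2 * inner ℝ (V q) (V q) + inner ℝ (W q) (W q)) -
    2 * inner ℝ (J (f q) (V q)) (W q)
  have hmin : IsLocalMin φ p := by
    refine Filter.Eventually.of_forall fun q ↦ ?_
    have hp : φ p = 0 := by
      simp only [φ, V, W, pushExtend_self]
      rw [← inner_tangentialPart (J (f p) (mfderiv I I' f p v)) hwm, ← hw, hww]
      ring
    rw [hp]
    have hPq := inner_tangentialPart_tangentialPart (hP q) (pushExtend_mem v q)
      (pushExtend_mem v q)
    have hVW := inner_tangentialPart (J (f q) (V q)) (pushExtend_mem (I' := I') (f := f) w q)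
    have hsq := real_inner_self_nonneg (x := tangentialPart I I' f q (J (f q) (V q)) - W q)
    rw [inner_sub_sub_self, hPq, real_inner_comm _ (W q), hVW] at hsq
    simp only [φ]
    simp only [V, W] at hsq ⊢
    linarith
  have hφ := mvfderiv_eq_zero_of_isLocalMin (I := I) hmin
  obtain ⟨x, hx, y, hy, e1, e2, e3⟩ :=
    exists_mvfderiv_kaehlerForm hJ hf.contMDiff humb w v w
  have hd : mvfderiv I φ p w =
      c ^ 2 * mvfderiv I (fun q ↦ inner ℝ (V q) (V q)) p w +
        mvfderiv I (fun q ↦ inner ℝ (W q) (W q)) p w -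
        2 * mvfderiv I (fun q ↦ inner ℝ (J (f q) (V q)) (W q)) p w := by
    have c2 : MDiffAt (fun q ↦ c ^ 2 * inner ℝ (V q) (V q)) p ∧ ∀ u,
        mvfderiv I (fun q ↦ c ^ 2 * inner ℝ (V q) (V q)) p u =
          c ^ 2 * mvfderiv I (fun q ↦ inner ℝ (V q) (V q)) p u :=
      mvfderiv_clm_comp ((c ^ 2) • ContinuousLinearMap.id ℝ ℝ) d2
    have c1 : MDiffAt (fun q ↦ 2 * inner ℝ (J (f q) (V q)) (W q)) p ∧ ∀ u,
        mvfderiv I (fun q ↦ 2 * inner ℝ (J (f q) (V q)) (W q)) p u =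
          2 * mvfderiv I (fun q ↦ inner ℝ (J (f q) (V q)) (W q)) p u :=
      mvfderiv_clm_comp ((2 : ℝ) • ContinuousLinearMap.id ℝ ℝ) d1
    have c3 : MDiffAt (fun q ↦ c ^ 2 * inner ℝ (V q) (V q) + inner ℝ (W q) (W q)) p :=
      c2.1.add d3
    rw [mvfderiv_fun_sub c3 c1.1, mvfderiv_fun_add c2.1 d3, sub_apply, add_apply, c2.2, c1.2]
  rw [hφ, e1, e2, e3] at hd
  -- With `hJv`, this cancels every term containing the tangential derivatives `x` and `y`.
  have hJx : inner ℝ (J (f p) x) (mfderiv I I' f p w) =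
      c ^ 2 * inner ℝ x (mfderiv I I' f p v) := by
    rw [← inner_tangentialPart (I := I) _ hwm, hw,
      inner_tangentialPart_tangentialPart (hP p) hx hvm]
  have hJv : inner ℝ (J (f p) (mfderiv I I' f p v)) y = inner ℝ y (mfderiv I I' f p w) := by
    rw [← inner_tangentialPart (J (f p) (mfderiv I I' f p v)) hy, hw, real_inner_comm]
  -- `J v ⟂ v` because `J` is skew; this removes the term with `⟨J H, w⟩`.
  have hvw : (inner ℝ w v : ℝ) = 0 := by
    rw [← hf.inner_mfderiv, hw, inner_tangentialPart _ hvm]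
    have h := hJ.inner_map_left (f p) (mfderiv I I' f p v) (mfderiv I I' f p v)
    have h' := real_inner_comm (mfderiv I I' f p v) (J (f p) (mfderiv I I' f p v))
    linarith
  have hw0 : (inner ℝ w w : ℝ) ≠ 0 := by
    rw [← hf.inner_mfderiv, hww, hf.inner_mfderiv]
    exact mul_ne_zero (pow_ne_zero _ hc) (inner_self_ne_zero.2 hv0)
  rw [hJx, hJv, hvw, zero_apply] at hd
  refine (mul_eq_zero.1 ?_).resolve_left hw0
  linarith

/-- The totally real case. -/
theorem inner_meanCurvature_of_totallyReal (hJ : IsKaehler I' J) (hf : IsIsometricImmersion I I' f)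
    (humb : IsTotallyUmbilical I I' f) (hdim : 2 ≤ Module.finrank ℝ E)
    (hP : ∀ q, ∀ x ∈ LinearMap.range (mfderiv I I' f q).toLinearMap,
      tangentialPart I I' f q (J (f q) x) = 0) {p : M} (w : TangentSpace I p) :
    inner ℝ (J (f p) (mfderiv I I' f p w)) (meanCurvature I I' f p) = 0 := by
  have hJ0 : ∀ q, ∀ x ∈ LinearMap.range (mfderiv I I' f q).toLinearMap,
      ∀ y ∈ LinearMap.range (mfderiv I I' f q).toLinearMap, inner ℝ (J (f q) x) y = 0 :=
    fun q x hx y hy ↦ by rw [← inner_tangentialPart (I := I) _ hy, hP q x hx, inner_zero_left]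
  -- With `u ⟂ w`, differentiating along `u` leaves only the term with `g(u, u)`.
  obtain ⟨u, hu, hu0⟩ : ∃ u ∈ (ℝ ∙ w)ᗮ, u ≠ 0 := by
    apply Submodule.exists_mem_ne_zero_of_ne_bot
    intro hbot
    have h1 := (ℝ ∙ w).finrank_add_finrank_orthogonal
    have h2 : Module.finrank ℝ (ℝ ∙ w) ≤ 1 :=
      (finrank_span_le_card ({w} : Set (TangentSpace I p))).trans (by simp)
    have h3 : Module.finrank ℝ (TangentSpace I p) = Module.finrank ℝ E := rfl
    rw [hbot, finrank_bot] at h1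
    omega
  have huw : (inner ℝ u w : ℝ) = 0 := by
    rw [real_inner_comm]
    exact Submodule.mem_orthogonal_singleton_iff_inner_right.1 hu
  obtain ⟨x, hx, y, hy, e1, -, -⟩ :=
    exists_mvfderiv_kaehlerForm hJ hf.contMDiff humb u u w
  have h0 : (fun q ↦ inner ℝ (J (f q) (pushExtend I I' f u q)) (pushExtend I I' f w q)) =
      fun _ ↦ (0 : ℝ) := by
    ext q
    exact hJ0 q _ (pushExtend_mem u q) _ (pushExtend_mem w q)
  have h1 : inner ℝ (J (f p) x) (mfderiv I I' f p w) = 0 := hJ0 p x hx _ ⟨w, rfl⟩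
  have h2 : inner ℝ (J (f p) (mfderiv I I' f p u)) y = 0 := hJ0 p _ ⟨u, rfl⟩ y hy
  rw [h0, mvfderiv_const, h1, h2, huw, zero_mul, hJ.inner_map_left, zero_apply] at e1
  rw [real_inner_comm]
  have hu1 : (inner ℝ u u : ℝ) ≠ 0 := inner_self_ne_zero.2 hu0
  refine (mul_eq_zero.1 ?_).resolve_left hu1
  linarith

/-- In half the dimension, a vector orthogonal to both `T M` and `J (T M)` vanishes, if the
tangential part of `J` is strictly contracting on `T M`. -/
theorem eq_zero_of_inner_eq_zero (hJ : IsKaehler I' J) (hf : IsIsometricImmersion I I' f)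
    (hdim : Module.finrank ℝ E' = 2 * Module.finrank ℝ E) {c : ℝ} (hc : c < 1) {p : M}
    (hP : ∀ x ∈ LinearMap.range (mfderiv I I' f p).toLinearMap,
      ‖tangentialPart I I' f p (J (f p) x)‖ = c * ‖x‖) {h : TangentSpace I' (f p)}
    (h1 : ∀ v, inner ℝ (mfderiv I I' f p v) h = 0)
    (h2 : ∀ v, inner ℝ (J (f p) (mfderiv I I' f p v)) h = 0) : h = 0 := by
  let T := LinearMap.range (mfderiv I I' f p).toLinearMap
  have hJinj : Function.Injective (J (f p)).toLinearMap := fun a b hab ↦ by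
    have := congrArg (J (f p)) (show J (f p) a = J (f p) b from hab)
    rwa [hJ.sq_eq_neg, hJ.sq_eq_neg, neg_inj] at this
  have hT : Module.finrank ℝ T = Module.finrank ℝ E :=
    LinearMap.finrank_range_of_inj (hf.injective_mfderiv p)
  have hJT : Module.finrank ℝ (T.map (J (f p)).toLinearMap) = Module.finrank ℝ E :=
    (LinearEquiv.finrank_eq (Submodule.equivMapOfInjective _ hJinj T)).symm.trans hT
  -- If `y` and `J y` are both tangent, projection fixes `J y`, so `|y| = c |y|`, and `c < 1` forces
  -- `y = 0`.
  have hdisj : Disjoint T (T.map (J (f p)).toLinearMap) := by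
    rw [Submodule.disjoint_def]
    rintro _ hx ⟨y, hy, rfl⟩
    have hfix : tangentialPart I I' f p (J (f p) y) = J (f p) y :=
      Submodule.starProjection_eq_self_iff.2 hx
    have hn := hP y hy
    rw [hfix, hJ.norm_map] at hn
    have : y = 0 := by
      by_contra hy0
      have := norm_pos_iff.2 hy0
      nlinarith
    rw [this, map_zero]
  have htop : T ⊔ T.map (J (f p)).toLinearMap = ⊤ := by
    refine Submodule.eq_top_of_disjoint _ _ ?_ hdisj
    have h3 : Module.finrank ℝ (TangentSpace I' (f p)) = Module.finrank ℝ E' := rfl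
    rw [hT, hJT, h3, hdim]
    omega
  have hmem : h ∈ T ⊔ T.map (J (f p)).toLinearMap := htop ▸ Submodule.mem_top
  obtain ⟨_, ⟨a, rfl⟩, _, ⟨_, ⟨b, rfl⟩, rfl⟩, hab⟩ := Submodule.mem_sup.1 hmem
  refine inner_self_eq_zero (𝕜 := ℝ).1 ?_
  -- Only the left factor of `⟨h, h⟩` is decomposed as tangent plus `J` of tangent; each piece is
  -- orthogonal to `h`.
  conv_lhs => rw [← hab]
  rw [inner_add_left, hab]
  have ha := h1 a
  have hb := h2 b
  change inner ℝ (mfderiv I I' f p a) h + inner ℝ (J (f p) (mfderiv I I' f p b)) h = 0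
  rw [ha, hb, add_zero]

theorem isTotallyGeodesic_of_isSlantWithAngle (hJ : IsKaehler I' J)
    (hf : IsIsometricImmersion I I' f) (hdim : 2 ≤ Module.finrank ℝ E)
    (hdim' : Module.finrank ℝ E' = 2 * Module.finrank ℝ E) {θ : ℝ}
    (hslant : IsSlantWithAngle I I' J f θ) (hθ : θ ≠ 0) (humb : IsTotallyUmbilical I I' f) :
    IsTotallyGeodesic I I' f := by
  intro p u v
  have hnt : Nontrivial E := Module.nontrivial_of_finrank_pos (R := ℝ) (by omega)
  obtain ⟨X, hX⟩ := exists_ne (0 : E)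
  -- The tangent space at `p` is definitionally the model space `E`, so `X` serves as a nonzero
  -- tangent vector.
  have hc := hslant.cos_nonneg_lt_one hθ (p := p) (X := X) hX
  have hP : ∀ q, ∀ x ∈ LinearMap.range (mfderiv I I' f q).toLinearMap,
      ‖tangentialPart I I' f q (J (f q) x)‖ = Real.cos θ * ‖x‖ :=
    fun q x hx ↦ hslant.norm_tangentialPart hJ hx
  have hH : meanCurvature I I' f p = 0 := by
    refine eq_zero_of_inner_eq_zero hJ hf hdim' hc.2 (hP p) (fun w ↦ ?_) fun w ↦ ?_
    · rw [real_inner_comm]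
      exact inner_meanCurvature ⟨w, rfl⟩
    · by_cases h0 : Real.cos θ = 0
      · refine inner_meanCurvature_of_totallyReal hJ hf humb hdim (fun q x hx ↦ ?_) w
        rw [← norm_eq_zero, hP q x hx, h0, zero_mul]
      · exact inner_meanCurvature_of_ne_zero hJ hf humb h0 hP w
  rw [humb p u v, hH, smul_zero]

end Umbilical

end SlantGeometry

end

theorem mainTheorem7 (n : ℕ) (hn : 2 ≤ n)
    -- a Kaehler manifold `(N, J, g)` of real dimension `2n`
    {N : Type*} [TopologicalSpace N] [ChartedSpace (EuclideanSpace ℝ (Fin (2 * n))) N]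
    [IsManifold (𝓡 (2 * n)) ∞ N]
    [RiemannianBundle (fun x : N ↦ TangentSpace (𝓡 (2 * n)) x)]
    [IsContMDiffRiemannianBundle (𝓡 (2 * n)) ∞ (EuclideanSpace ℝ (Fin (2 * n)))
      (fun x : N ↦ TangentSpace (𝓡 (2 * n)) x)]
    (J : Π x : N, TangentSpace (𝓡 (2 * n)) x →L[ℝ] TangentSpace (𝓡 (2 * n)) x)
    (hJ : SlantGeometry.IsKaehler (𝓡 (2 * n)) J)
    -- an `n`-dimensional submanifold `f : M → N` with its induced metric
    {M : Type*} [TopologicalSpace M] [ChartedSpace (EuclideanSpace ℝ (Fin n)) M]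
    [IsManifold (𝓡 n) ∞ M]
    [RiemannianBundle (fun x : M ↦ TangentSpace (𝓡 n) x)]
    [IsContMDiffRiemannianBundle (𝓡 n) ∞ (EuclideanSpace ℝ (Fin n))
      (fun x : M ↦ TangentSpace (𝓡 n) x)]
    (f : M → N) (hf : SlantGeometry.IsIsometricImmersion (𝓡 n) (𝓡 (2 * n)) f)
    -- which is slant, not invariant, and totally umbilical
    (θ : ℝ) (hslant : SlantGeometry.IsSlantWithAngle (𝓡 n) (𝓡 (2 * n)) J f θ) (hθ : θ ≠ 0)
    (humb : SlantGeometry.IsTotallyUmbilical (𝓡 n) (𝓡 (2 * n)) f) :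
    SlantGeometry.IsTotallyGeodesic (𝓡 n) (𝓡 (2 * n)) f := by
  exact SlantGeometry.isTotallyGeodesic_of_isSlantWithAngle hJ hf (by simpa using hn) (by simp)
    hslant hθ humb
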